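/- Let $1\le k\le p$ be integers and let $$\widetilde{\mathcal A}_k^p=\Big\{a\in\mathbb R^p:\ \|a\|_0=k,\ |a_i|=\tfrac1{\sqrt k}\ \text{ for all } i\in\operatorname{supp}(a)\Big\}.$$ Let $\kappa_k$ be the norm on $\mathbb R^p$ whose unit ball is the convex hull of $\widetilde{\mathcal A}_k^p$, that is, the atomic norm $\kappa_k(x)=\inf\{t>0:\ x\in t\,\mathrm{conv}(\widetilde{\mathcal A}_k^p)\}$. For a convex function $\Omega:\mathbb R^p\to\mathbb R$ and $a\in\mathbb R^p$, let $$T_\Omega(a)=\overline{\bigcup_{\tau>0}\{h\in\mathbb R^p:\ \Omega(a+\tau h)\le\Omega(a)\}}$$ be the tangent cone of $\Omega$ at $a$, and let $\mathfrak S(a,\Omega)=\mathbb E\big[\|\Pi_{T_\Omega(a)}(G)\|_2^2\big]$ be the statistical dimension of $\Omega$ at $a$, where $G$ is a random vector in $\mathbb R^p$ with i.i.d. standard normal entries and $\Pi_{T_\Omega(a)}$ is the orthogonal projection onto the closed convex cone $T_\Omega(a)$. Then for every $a\in\widetilde{\mathcal A}_k^p$ the expectation defining $\mathfrak S(a,\kappa_k)$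 is finite and $$\frac{k}{2\pi}\log\Big(\frac{p-k}{k+1}\Big)\ \le\ \mathfrak S(a,\kappa_k)\ \le\ 9k\log\frac pk+16(k+1),$$ where $\log$ is the natural logarithm (for $p=k$ the lower bound is $-\infty$ and carries no information). -/

import Mathlib

open MeasureTheory ProbabilityTheory

noncomputable section

/-- The set `Ã_k^p` of vectors of `ℝ^p` with exactly `k` nonzero entries, all of which have
absolute value `1 / √k`. -/
def cutAtoms (k p : ℕ) : Set (EuclideanSpace ℝ (Fin p)) :=
  {a | {i | a i ≠ 0}.ncard = k ∧ ∀ i, a i ≠ 0 → |a i| = 1 / √(k : ℝ)}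

/-- The atomic norm induced by a set of atoms `A`: the gauge
`x ↦ inf {t > 0 | x ∈ t • conv A}` of its convex hull. -/
def atomicNorm {E : Type*} [AddCommGroup E] [Module ℝ E] (A : Set E) (x : E) : ℝ :=
  gauge (convexHull ℝ A) x

/-- The norm `κ_k` on `ℝ^p`: the atomic norm induced by `Ã_k^p`. -/
def kappaNorm (k p : ℕ) (x : EuclideanSpace ℝ (Fin p)) : ℝ :=
  atomicNorm (cutAtoms k p) x

/-- The tangent cone of `Ω` at `z`: the closure of the cone of descent directions,
`⋃_{τ > 0} {h | Ω (z + τ h) ≤ Ω z}`. -/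
def descentTangentCone {E : Type*} [NormedAddCommGroup E] [NormedSpace ℝ E]
    (Ω : E → ℝ) (z : E) : Set E :=
  closure (⋃ τ > (0 : ℝ), {h | Ω (z + τ • h) ≤ Ω z})

/-- The (orthogonal) projection of `x` onto `C`: the point of `C` closest to `x`. It exists and is
unique when `C` is a nonempty closed convex set of a Euclidean space, see `metricProj_spec` and
`eq_metricProj`. -/
def metricProj {E : Type*} [NormedAddCommGroup E] (C : Set E) (x : E) : E :=
  Classical.epsilon fun y => y ∈ C ∧ ∀ z ∈ C, ‖x - y‖ ≤ ‖x - z‖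

theorem metricProj_spec {E : Type*} [NormedAddCommGroup E] [InnerProductSpace ℝ E]
    [FiniteDimensional ℝ E] {C : Set E} (hne : C.Nonempty) (hcl : IsClosed C) (x : E) :
    metricProj C x ∈ C ∧ ∀ z ∈ C, ‖x - metricProj C x‖ ≤ ‖x - z‖ := by
  have h : ∃ y, y ∈ C ∧ ∀ z ∈ C, ‖x - y‖ ≤ ‖x - z‖ := by
    obtain ⟨y, hy, hxy⟩ := hcl.exists_infDist_eq_dist hne x
    refine ⟨y, hy, fun z hz => ?_⟩
    rw [← dist_eq_norm, ← dist_eq_norm, ← hxy]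
    exact Metric.infDist_le_dist_of_mem hz
  exact Classical.epsilon_spec h

theorem eq_metricProj {E : Type*} [NormedAddCommGroup E] [InnerProductSpace ℝ E]
    [FiniteDimensional ℝ E] {C : Set E} (hcl : IsClosed C) (hconv : Convex ℝ C) {x y : E}
    (hy : y ∈ C) (hmin : ∀ z ∈ C, ‖x - y‖ ≤ ‖x - z‖) : y = metricProj C x := by
  obtain ⟨hq, hqmin⟩ := metricProj_spec ⟨y, hy⟩ hcl x
  set q := metricProj C x
  have heq : ‖x - y‖ = ‖x - q‖ := le_antisymm (hmin q hq) (hqmin y hy)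
  have hm := hmin _ (hconv hy hq (a := 1 / 2) (b := 1 / 2) (by norm_num) (by norm_num)
    (by norm_num))
  have hpar := parallelogram_law_with_norm ℝ (x - y) (x - q)
  have e1 : x - y + (x - q) = (2 : ℝ) • (x - ((1 / 2 : ℝ) • y + (1 / 2 : ℝ) • q)) := by module
  have e2 : x - y - (x - q) = q - y := by abel
  rw [e1, e2, norm_smul, Real.norm_of_nonneg (by norm_num : (0 : ℝ) ≤ 2), ← heq] at hpar
  have h0 : ‖q - y‖ = 0 := by
    nlinarith [norm_nonneg (q - y), norm_nonneg (x - y), mul_self_le_mul_self (norm_nonneg _) hm]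
  exact (sub_eq_zero.mp (norm_eq_zero.mp h0)).symm

theorem zero_mem_descentTangentCone {E : Type*} [NormedAddCommGroup E] [NormedSpace ℝ E]
    (Ω : E → ℝ) (z : E) : (0 : E) ∈ descentTangentCone Ω z := by
  refine subset_closure (Set.mem_iUnion₂.mpr ⟨1, one_pos, ?_⟩)
  simp

theorem convex_descentTangentCone {E : Type*} [NormedAddCommGroup E] [NormedSpace ℝ E]
    {Ω : E → ℝ} (hΩ : ConvexOn ℝ Set.univ Ω) (z : E) : Convex ℝ (descentTangentCone Ω z) := by
  refine Convex.closure ?_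
  have shrink : ∀ {σ τ : ℝ} {h : E}, 0 < σ → σ ≤ τ → Ω (z + τ • h) ≤ Ω z →
      Ω (z + σ • h) ≤ Ω z := by
    intro σ τ h hσ hστ hh
    have hτ : 0 < τ := hσ.trans_le hστ
    have c₁ : 0 ≤ 1 - σ / τ := sub_nonneg.mpr ((div_le_one hτ).mpr hστ)
    have c₂ : 0 ≤ σ / τ := by positivity
    have h1 := hΩ.2 (Set.mem_univ z) (Set.mem_univ (z + τ • h)) c₁ c₂ (by ring)
    have e : (1 - σ / τ) • z + (σ / τ) • (z + τ • h) = z + σ • h := by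
      rw [smul_add, smul_smul, div_mul_cancel₀ _ hτ.ne']
      module
    rw [e] at h1
    simp only [smul_eq_mul] at h1
    nlinarith
  intro h₁ m₁ h₂ m₂ a b ha hb hab
  simp only [Set.mem_iUnion, Set.mem_ofPred_eq, exists_prop] at m₁ m₂ ⊢
  obtain ⟨τ₁, p₁, q₁⟩ := m₁
  obtain ⟨τ₂, p₂, q₂⟩ := m₂
  refine ⟨min τ₁ τ₂, lt_min p₁ p₂, ?_⟩
  have r₁ := shrink (lt_min p₁ p₂) (min_le_left _ _) q₁
  have r₂ := shrink (lt_min p₁ p₂) (min_le_right _ _) q₂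
  set τ := min τ₁ τ₂
  have h1 := hΩ.2 (Set.mem_univ (z + τ • h₁)) (Set.mem_univ (z + τ • h₂)) ha hb hab
  have e : a • (z + τ • h₁) + b • (z + τ • h₂) = z + τ • (a • h₁ + b • h₂) := by
    obtain rfl : b = 1 - a := by linarith
    module
  rw [e] at h1
  simp only [smul_eq_mul] at h1
  obtain rfl : b = 1 - a := by linarith
  nlinarith

/-- The statistical dimension `𝔖(z, Ω) = 𝔼 ‖Π_{T_Ω(z)}(G)‖²` of `Ω` at `z`, where `G` is a standard
Gaussian vector. -/
def statDim {E : Type*} [NormedAddCommGroup E] [InnerProductSpace ℝ E] [FiniteDimensional ℝ E]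
    [MeasurableSpace E] [BorelSpace E] (z : E) (Ω : E → ℝ) : ℝ :=
  ∫ g, ‖metricProj (descentTangentCone Ω z) g‖ ^ 2 ∂(stdGaussian E)

end

/-! Let `T` be the tangent cone, `g` a Gaussian vector, and `L` a logarithm to be chosen. Both
bounds test the projection onto `T` against one explicit vector field; only the fact that `T` is a
closed cone is used. The two inequalities are `‖Π g‖² ≤ ‖g - y‖²` for every `y` in the polar of `T`,
and `‖Π g‖² ≥ 2⟪g, h⟫ - ‖h‖²` for every `h ∈ T`.

Upper bound: a vector `y` whose pairing with atoms is maximal at `a` lies in the polar. Clipping `g`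
to `[-t, t]` off the support of `a`, and raising its component along the sign of `a` to at least `t`
on the support, gives such a `y` (`inner_polarApprox_le`). The mean error is at most `k (1 + t²)` on
the support plus a Gaussian tail off it; `t²` of order `log (p / k)` balances the two.

Lower bound: replacing an entry of the support by `± 1 / √k` at a new coordinate gives another atom,
so the swap is a direction in `T`. Weighting the swaps by `exp (± t g_j)` produces a field `h` with
hyperbolic entries (`descentField_mem`), whose Gaussian moments are explicit. With `t² = L = log ((p
- k) / (k + 1))` they give `k L / 2`, more than is claimed. -/

section ConeProjection

/-! ### Projection onto a closed cone -/

variable {E : Type*} [NormedAddCommGroup E] [InnerProductSpace ℝ E] [FiniteDimensional ℝ E]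
  {C : Set E}

/-- The ray through the projection stays in the cone, so the quadratic `c ↦ ‖g - c q‖²` on `c ≥ 0`
is minimal at `c = 1`. -/
theorem inner_metricProj_of_cone (hcl : IsClosed C) (h0 : (0 : E) ∈ C)
    (hcone : ∀ c : ℝ, 0 ≤ c → ∀ h ∈ C, c • h ∈ C) (g : E) :
    inner ℝ g (metricProj C g) = ‖metricProj C g‖ ^ 2 := by
  obtain ⟨hq, hmin⟩ := metricProj_spec ⟨0, h0⟩ hcl g
  set q := metricProj C g
  have key : ∀ c : ℝ, 0 ≤ c →
      -2 * inner ℝ g q + ‖q‖ ^ 2 ≤ -2 * (c * inner ℝ g q) + c ^ 2 * ‖q‖ ^ 2 := by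
    intro c hc
    have h1 := pow_le_pow_left₀ (norm_nonneg _) (hmin _ (hcone c hc q hq)) 2
    rw [norm_sub_sq_real, norm_sub_sq_real, inner_smul_right, norm_smul, mul_pow,
      Real.norm_eq_abs, sq_abs] at h1
    linarith
  rcases eq_or_ne q 0 with h | h
  · simp [h]
  have hB : 0 < ‖q‖ ^ 2 := by positivity
  have hA : 0 ≤ inner ℝ g q := by linarith [key 0 le_rfl]
  -- This `c` is the vertex of the quadratic; comparison with `c = 1` forces `(⟪g, q⟫ - ‖q‖²)² ≤ 0`.
  have h1 := key (inner ℝ g q / ‖q‖ ^ 2) (by positivity)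
  have e : -2 * (inner ℝ g q / ‖q‖ ^ 2 * inner ℝ g q) + (inner ℝ g q / ‖q‖ ^ 2) ^ 2 * ‖q‖ ^ 2
      = -(inner ℝ g q ^ 2 / ‖q‖ ^ 2) := by
    field_simp; ring
  rw [e, le_neg, div_le_iff₀ hB] at h1
  nlinarith [sq_nonneg (inner ℝ g q - ‖q‖ ^ 2)]

/-- The distance on the right is continuous in `g`, which gives measurability of the left side
although the projection is defined by choice. -/
theorem norm_sq_metricProj_of_cone (hcl : IsClosed C) (h0 : (0 : E) ∈ C)
    (hcone : ∀ c : ℝ, 0 ≤ c → ∀ h ∈ C, c • h ∈ C) (g : E) :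
    ‖metricProj C g‖ ^ 2 = ‖g‖ ^ 2 - Metric.infDist g C ^ 2 := by
  have hd : Metric.infDist g C = ‖g - metricProj C g‖ := by
    obtain ⟨hq, hmin⟩ := metricProj_spec ⟨0, h0⟩ hcl g
    refine le_antisymm ?_ ((Metric.le_infDist ⟨0, h0⟩).2 fun {z} hz => ?_)
    · rw [← dist_eq_norm]; exact Metric.infDist_le_dist_of_mem hq
    · rw [dist_eq_norm]; exact hmin z hz
  rw [hd, norm_sub_sq_real, inner_metricProj_of_cone hcl h0 hcone]
  ring

theorem le_norm_sq_metricProj_of_cone (hcl : IsClosed C) (h0 : (0 : E) ∈ C)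
    (hcone : ∀ c : ℝ, 0 ≤ c → ∀ h ∈ C, c • h ∈ C) (g : E) {h : E} (hh : h ∈ C) :
    2 * inner ℝ g h - ‖h‖ ^ 2 ≤ ‖metricProj C g‖ ^ 2 := by
  have h1 := pow_le_pow_left₀ (norm_nonneg _) ((metricProj_spec ⟨0, h0⟩ hcl g).2 h hh) 2
  rw [norm_sub_sq_real, norm_sub_sq_real, inner_metricProj_of_cone hcl h0 hcone] at h1
  linarith

/-- Expand `0 ≤ ‖g - y - Π g‖²`: since `⟪g, Π g⟫ = ‖Π g‖²` and `⟪y, Π g⟫ ≤ 0`, the right side is at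
most `‖g - y‖² - ‖Π g‖²`. -/
theorem norm_sq_metricProj_le_of_polar (hcl : IsClosed C) (h0 : (0 : E) ∈ C)
    (hcone : ∀ c : ℝ, 0 ≤ c → ∀ h ∈ C, c • h ∈ C) (g : E) {y : E}
    (hy : ∀ h ∈ C, inner ℝ y h ≤ 0) :
    ‖metricProj C g‖ ^ 2 ≤ ‖g - y‖ ^ 2 := by
  have h1 := hy _ (metricProj_spec ⟨0, h0⟩ hcl g).1
  have h2 := norm_sub_sq_real (g - y) (metricProj C g)
  rw [inner_sub_left, inner_metricProj_of_cone hcl h0 hcone] at h2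
  nlinarith [sq_nonneg ‖g - y - metricProj C g‖]

end ConeProjection

theorem smul_mem_descentTangentCone {E : Type*} [NormedAddCommGroup E] [NormedSpace ℝ E]
    (Ω : E → ℝ) (z : E) (c : ℝ) (hc : 0 ≤ c) (h : E) (hh : h ∈ descentTangentCone Ω z) :
    c • h ∈ descentTangentCone Ω z := by
  rcases hc.eq_or_lt with rfl | hc
  · simpa using zero_mem_descentTangentCone Ω z
  refine map_mem_closure (continuous_const_smul c) hh fun x hx => ?_
  simp only [Set.mem_iUnion, Set.mem_ofPred_eq, exists_prop] at hx ⊢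
  obtain ⟨τ, hτ, hx⟩ := hx
  refine ⟨τ / c, by positivity, ?_⟩
  rwa [smul_smul, div_mul_cancel₀ _ hc.ne']

/-- The cone of directions in which one can move from `z` while staying in `K`. -/
def feasibleDirections {E : Type*} [AddCommGroup E] [Module ℝ E] (K : Set E) (z : E) : Set E :=
  {h | ∃ τ > (0 : ℝ), z + τ • h ∈ K}

section FeasibleDirections

variable {E : Type*} [AddCommGroup E] [Module ℝ E] {K : Set E} {z : E}

theorem smul_mem_feasibleDirections (hz : z ∈ K) {c : ℝ} (hc : 0 ≤ c) {h : E}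
    (hh : h ∈ feasibleDirections K z) : c • h ∈ feasibleDirections K z := by
  rcases hc.eq_or_lt with rfl | hc
  · exact ⟨1, one_pos, by simpa using hz⟩
  obtain ⟨τ, hτ, hx⟩ := hh
  refine ⟨τ / c, by positivity, ?_⟩
  rwa [smul_smul, div_mul_cancel₀ _ hc.ne']

theorem add_mem_feasibleDirections (hK : Convex ℝ K) {h₁ h₂ : E}
    (hh₁ : h₁ ∈ feasibleDirections K z) (hh₂ : h₂ ∈ feasibleDirections K z) :
    h₁ + h₂ ∈ feasibleDirections K z := by
  obtain ⟨σ, hσ, hx⟩ := hh₁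
  obtain ⟨τ, hτ, hy⟩ := hh₂
  -- The weights `τ / (σ + τ)` and `σ / (σ + τ)` equalise the two step lengths.
  refine ⟨σ * τ / (σ + τ), by positivity, ?_⟩
  have := hK hx hy (a := τ / (σ + τ)) (b := σ / (σ + τ)) (by positivity) (by positivity)
    (by field_simp; ring)
  convert! this using 1
  match_scalars <;> field_simp
  ring

theorem sum_mem_feasibleDirections (hK : Convex ℝ K) (hz : z ∈ K) {ι : Type*} (s : Finset ι)
    {f : ι → E} (hf : ∀ i ∈ s, f i ∈ feasibleDirections K z) :
    ∑ i ∈ s, f i ∈ feasibleDirections K z :=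
  Finset.sum_induction f (· ∈ feasibleDirections K z)
    (fun _ _ => add_mem_feasibleDirections hK) ⟨1, one_pos, by simpa using hz⟩ hf

end FeasibleDirections

/-! ### Atoms, their convex hull and the norm `κ_k` -/

section CutAtoms

open scoped Pointwise

variable {k p : ℕ} {a b : EuclideanSpace ℝ (Fin p)}

theorem card_support_of_mem_cutAtoms (ha : a ∈ cutAtoms k p) :
    (Finset.univ.filter fun i => a i ≠ 0).card = k := by
  have h := ha.1
  rw [Set.ncard_eq_toFinset_card'] at h
  convert! h
  ext i
  simp

theorem abs_le_of_mem_cutAtoms (ha : a ∈ cutAtoms k p) (i : Fin p) : |a i| ≤ 1 / √(k : ℝ) := by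
  by_cases h : a i = 0
  · rw [h, abs_zero]; positivity
  · exact (ha.2 i h).le

theorem sum_eq_sum_support (a : EuclideanSpace ℝ (Fin p)) (f : Fin p → ℝ)
    (hf : ∀ i, a i = 0 → f i = 0) :
    ∑ i, f i = ∑ i with a i ≠ 0, f i := by
  rw [Finset.sum_filter]
  refine Finset.sum_congr rfl fun i _ => ?_
  split_ifs with h
  · rfl
  · exact hf i (not_not.1 h)

theorem sum_abs_of_mem_cutAtoms (ha : a ∈ cutAtoms k p) :
    ∑ i, |a i| = √(k : ℝ) := by
  rw [sum_eq_sum_support a _ (by simp), Finset.sum_congr rfl fun i hi =>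
    ha.2 i (Finset.mem_filter.1 hi).2, Finset.sum_const, card_support_of_mem_cutAtoms ha,
    nsmul_eq_mul, mul_one_div, Real.div_sqrt]

theorem sq_of_mem_cutAtoms (ha : a ∈ cutAtoms k p) {i : Fin p} (hi : a i ≠ 0) :
    a i ^ 2 = 1 / k := by
  rw [← sq_abs, ha.2 i hi, div_pow, Real.sq_sqrt (by positivity), one_pow]

theorem norm_sq_of_mem_cutAtoms (hk : 1 ≤ k) (ha : a ∈ cutAtoms k p) : ‖a‖ ^ 2 = 1 := by
  rw [EuclideanSpace.real_norm_sq_eq, sum_eq_sum_support a _ (by simp +contextual),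
    Finset.sum_congr rfl fun i hi => sq_of_mem_cutAtoms (i := i) ha (Finset.mem_filter.1 hi).2,
    Finset.sum_const, card_support_of_mem_cutAtoms ha, nsmul_eq_mul]
  have : (k : ℝ) ≠ 0 := by positivity
  field_simp

theorem mem_cutAtoms_of_abs_eq (ha : a ∈ cutAtoms k p) (h : ∀ i, |b i| = |a i|) :
    b ∈ cutAtoms k p := by
  have h0 : ∀ i, b i ≠ 0 ↔ a i ≠ 0 := fun i => by rw [← abs_ne_zero, h, abs_ne_zero]
  refine ⟨?_, fun i hi => by rw [h, ha.2 i ((h0 i).1 hi)]⟩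
  simp_rw [h0]
  exact ha.1

theorem swap_mem_cutAtoms (hk : 1 ≤ k) (ha : a ∈ cutAtoms k p) {i j : Fin p} (hi : a i ≠ 0)
    (hj : a j = 0) {v : ℝ} (hv : |v| = 1 / √(k : ℝ)) :
    a + (EuclideanSpace.single j v - EuclideanSpace.single i (a i)) ∈ cutAtoms k p := by
  have hij : i ≠ j := by rintro rfl; exact hi hj
  have hv0 : v ≠ 0 := by
    rw [← abs_ne_zero, hv]
    have : 0 < (k : ℝ) := by positivity
    positivity
  set b := a + (EuclideanSpace.single j v - EuclideanSpace.single i (a i)) with hb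
  have hbi : b i = 0 := by simp [hb, hij]
  have hbj : b j = v := by simp [hb, hij.symm, hj]
  have hbl : ∀ l, l ≠ i → l ≠ j → b l = a l := fun l h1 h2 => by simp [hb, h1, h2]
  constructor
  · have hs : {l | b l ≠ 0} = insert j ({l | a l ≠ 0} \ {i}) := by
      ext l
      simp only [Set.mem_ofPred_eq, Set.mem_insert_iff, Set.mem_sdiff, Set.mem_singleton_iff]
      by_cases h1 : l = i
      · subst h1; simp [hbi, hij]
      by_cases h2 : l = j
      · subst h2; simp [hbj, hv0]
      simp [hbl l h1 h2, h1, h2]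
    have hi' : i ∈ {l | a l ≠ 0} := hi
    rw [hs, Set.ncard_insert_of_notMem (by simp [hj]), Set.ncard_sdiff_singleton_add_one hi']
    exact ha.1
  · intro l hl
    by_cases h1 : l = i
    · subst h1; exact absurd hbi hl
    by_cases h2 : l = j
    · subst h2; rwa [hbj]
    rw [hbl l h1 h2] at hl ⊢
    exact ha.2 l hl

/-- The dilates of `conv (Ã_k^p)` cover the whole space. -/
theorem exists_mem_smul_convexHull_cutAtoms (hk : 1 ≤ k) (ha : a ∈ cutAtoms k p)
    (x : EuclideanSpace ℝ (Fin p)) :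
    ∃ r > (0 : ℝ), x ∈ r • convexHull ℝ (cutAtoms k p) := by
  have hneg : ∀ {c}, c ∈ cutAtoms k p → -c ∈ cutAtoms k p := fun hc =>
    mem_cutAtoms_of_abs_eq hc fun i => by simp
  have h0 : (0 : EuclideanSpace ℝ (Fin p)) ∈ convexHull ℝ (cutAtoms k p) := by
    have := convex_convexHull ℝ (cutAtoms k p) (subset_convexHull ℝ _ ha)
      (subset_convexHull ℝ _ (hneg ha)) (a := 1 / 2) (b := 1 / 2) (by norm_num) (by norm_num)
      (by norm_num)
    simpa using this
  have hsub : ∀ y ∈ feasibleDirections (convexHull ℝ (cutAtoms k p)) 0,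
      ∃ r > (0 : ℝ), y ∈ r • convexHull ℝ (cutAtoms k p) := by
    rintro y ⟨τ, hτ, hy⟩
    refine ⟨τ⁻¹, by positivity, (Set.mem_smul_set_iff_inv_smul_mem₀ (by positivity) _ _).2 ?_⟩
    simpa using hy
  apply hsub
  have hatom : ∀ {c}, c ∈ cutAtoms k p → c ∈ feasibleDirections (convexHull ℝ (cutAtoms k p)) 0 :=
    fun hc => ⟨1, one_pos, by simpa using subset_convexHull ℝ _ hc⟩
  have hsingle : ∀ {c} (i : Fin p) (t : ℝ), c ∈ cutAtoms k p → c i ≠ 0 →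
      EuclideanSpace.single i t ∈ feasibleDirections (convexHull ℝ (cutAtoms k p)) 0 := by
    intro c i t hc hi
    -- Flipping every sign except that of coordinate `i` gives an atom; adding `c` back leaves `2
    -- c_i e_i`.
    have hflip : EuclideanSpace.single i (2 * c i) - c ∈ cutAtoms k p := by
      refine mem_cutAtoms_of_abs_eq hc fun l => ?_
      by_cases h : l = i
      · subst h; simp; ring_nf
      · simp [h]
    rcases le_total 0 (t / (2 * c i)) with h | h
    · convert! smul_mem_feasibleDirections h0 h (add_mem_feasibleDirections
        (convex_convexHull ℝ _) (hatom hflip) (hatom hc)) using 1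
      ext l
      by_cases hl : l = i
      · subst hl; simp; field_simp
      · simp [hl]
    · convert! smul_mem_feasibleDirections h0 (neg_nonneg.2 h) (add_mem_feasibleDirections
        (convex_convexHull ℝ _) (hatom (hneg hflip)) (hatom (hneg hc))) using 1
      ext l
      by_cases hl : l = i
      · subst hl; simp; field_simp; ring
      · simp [hl]
  have hx : x = ∑ i, EuclideanSpace.single i (x i) := by
    ext l
    simp [Finset.sum_apply, Pi.single_apply]
  rw [hx]
  refine sum_mem_feasibleDirections (convex_convexHull ℝ _) h0 _ fun j _ => ?_
  by_cases hj : a j = 0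
  · obtain ⟨i, hi⟩ : ∃ i, a i ≠ 0 := by
      by_contra! h
      have := card_support_of_mem_cutAtoms ha
      simp [h] at this
      omega
    -- A coordinate outside the support of `a` is first brought into the support of another atom.
    refine hsingle j _ (swap_mem_cutAtoms hk ha hi hj (v := 1 / √(k : ℝ))
      (abs_of_nonneg (by positivity))) ?_
    have hij : j ≠ i := by rintro rfl; exact hi hj
    have : 0 < (k : ℝ) := by positivity
    simp [hij, hj]
    omega
  · exact hsingle j _ ha hj

theorem inner_le_of_mem_convexHull {A : Set (EuclideanSpace ℝ (Fin p))}
    {x y : EuclideanSpace ℝ (Fin p)} {M : ℝ} (hy : ∀ b ∈ A, inner ℝ y b ≤ M)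
    (hx : x ∈ convexHull ℝ A) : inner ℝ y x ≤ M := by
  have : convexHull ℝ A ⊆ {z | inner ℝ y z ≤ M} :=
    convexHull_min hy (convex_halfSpace_le (innerₛₗ ℝ y).isLinear M)
  exact this hx

theorem kappaNorm_le_one_of_mem {x : EuclideanSpace ℝ (Fin p)}
    (hx : x ∈ convexHull ℝ (cutAtoms k p)) : kappaNorm k p x ≤ 1 :=
  gauge_le_one_of_mem hx

/-- Pairing with `a` is at most `1` on the hull, because all atoms are unit vectors, and equals `1`
at `a`. -/
theorem one_le_kappaNorm (hk : 1 ≤ k) (ha : a ∈ cutAtoms k p) : 1 ≤ kappaNorm k p a := by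
  refine le_csInf (exists_mem_smul_convexHull_cutAtoms hk ha a) ?_
  rintro r ⟨hr, x, hx, hxa⟩
  have h1 : inner ℝ a x ≤ 1 := inner_le_of_mem_convexHull (fun b hb => by
    have := real_inner_le_norm a b
    have e1 := norm_sq_of_mem_cutAtoms hk ha
    have e2 := norm_sq_of_mem_cutAtoms hk hb
    nlinarith [sq_nonneg (‖a‖ - ‖b‖)]) hx
  have h2 : inner ℝ a (r • x) = 1 := by
    rw [show r • x = a from hxa, real_inner_self_eq_norm_sq, norm_sq_of_mem_cutAtoms hk ha]
  rw [inner_smul_right] at h2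
  nlinarith

theorem inner_le_of_kappaNorm_le_one (hk : 1 ≤ k) (ha : a ∈ cutAtoms k p)
    {x y : EuclideanSpace ℝ (Fin p)} (hy : ∀ b ∈ cutAtoms k p, inner ℝ y b ≤ inner ℝ y a)
    (hx : kappaNorm k p x ≤ 1) : inner ℝ y x ≤ inner ℝ y a := by
  have hM : 0 ≤ inner ℝ y a := by
    have := hy (-a) (mem_cutAtoms_of_abs_eq ha fun i => by simp)
    rw [inner_neg_right] at this
    linarith
  -- The slack `ε` avoids proving that the hull is closed: `x` is only known to lie in `r • conv`
  -- for `r` slightly above `1`. The `+ 1` in the denominator covers a vanishing maximum.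
  refine le_of_forall_pos_le_add fun ε hε => ?_
  have hlt : kappaNorm k p x < 1 + ε / (inner ℝ y a + 1) := hx.trans_lt (by
    have : 0 < ε / (inner ℝ y a + 1) := by positivity
    linarith)
  obtain ⟨r, ⟨hr, z, hz, rfl⟩, hr'⟩ :=
    exists_lt_of_csInf_lt (exists_mem_smul_convexHull_cutAtoms hk ha x) hlt
  have h1 := inner_le_of_mem_convexHull hy hz
  change inner ℝ y (r • z) ≤ _
  rw [inner_smul_right]
  calc r * inner ℝ y z ≤ r * inner ℝ y a := by gcongr
    _ ≤ (1 + ε / (inner ℝ y a + 1)) * inner ℝ y a := by gcongr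
    _ = inner ℝ y a + ε * (inner ℝ y a / (inner ℝ y a + 1)) := by ring
    _ ≤ inner ℝ y a + ε * 1 := by
        gcongr
        exact div_le_one_of_le₀ (by linarith) (by positivity)
    _ = _ := by ring

/-- The sublevel set of `κ_k` at `a` lies in the half-space supported by `y` at `a`, so every
descent direction pairs nonpositively with `y`, and so do their limits. -/
theorem inner_nonpos_of_mem_descentTangentCone (hk : 1 ≤ k) (ha : a ∈ cutAtoms k p)
    {y h : EuclideanSpace ℝ (Fin p)} (hy : ∀ b ∈ cutAtoms k p, inner ℝ y b ≤ inner ℝ y a)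
    (hh : h ∈ descentTangentCone (kappaNorm k p) a) : inner ℝ y h ≤ 0 := by
  have hcl : IsClosed {z : EuclideanSpace ℝ (Fin p) | inner ℝ y z ≤ 0} :=
    isClosed_le (by fun_prop) continuous_const
  refine closure_minimal ?_ hcl hh
  intro z hz
  simp only [Set.mem_iUnion, Set.mem_ofPred_eq, exists_prop] at hz ⊢
  obtain ⟨τ, hτ, hz⟩ := hz
  have h1 := inner_le_of_kappaNorm_le_one hk ha hy
    (hz.trans (kappaNorm_le_one_of_mem (subset_convexHull ℝ _ ha)))
  rw [inner_add_right, inner_smul_right] at h1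
  nlinarith

theorem feasibleDirections_subset_descentTangentCone (hk : 1 ≤ k) (ha : a ∈ cutAtoms k p) :
    feasibleDirections (convexHull ℝ (cutAtoms k p)) a
      ⊆ descentTangentCone (kappaNorm k p) a := by
  rintro h ⟨τ, hτ, hh⟩
  refine subset_closure (Set.mem_iUnion₂.mpr ⟨τ, hτ, ?_⟩)
  exact (kappaNorm_le_one_of_mem hh).trans (one_le_kappaNorm hk ha)

end CutAtoms

/-! ### Hyperbolic and quadratic moments of a scalar Gaussian -/

section ScalarGaussian

theorem integrable_cosh_gaussianReal (t : ℝ) :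
    Integrable (fun x => Real.cosh (t * x)) (gaussianReal 0 1) := by
  simp_rw [Real.cosh_eq]
  have h1 := integrable_exp_mul_gaussianReal (μ := 0) (v := 1) t
  have h2 := integrable_exp_mul_gaussianReal (μ := 0) (v := 1) (-t)
  simp_rw [neg_mul] at h2
  exact (h1.add h2).div_const 2

theorem integral_exp_gaussianReal (t : ℝ) :
    ∫ x, Real.exp (t * x) ∂gaussianReal 0 1 = Real.exp (t ^ 2 / 2) := by
  have := congrFun (mgf_fun_id_gaussianReal (μ := 0) (v := 1)) t
  simpa [mgf] using this

theorem integral_cosh_gaussianReal (t : ℝ) :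
    ∫ x, Real.cosh (t * x) ∂gaussianReal 0 1 = Real.exp (t ^ 2 / 2) := by
  simp_rw [Real.cosh_eq]
  have h1 := integrable_exp_mul_gaussianReal (μ := 0) (v := 1) t
  have h2 := integrable_exp_mul_gaussianReal (μ := 0) (v := 1) (-t)
  have e1 := integral_exp_gaussianReal t
  have e2 := integral_exp_gaussianReal (-t)
  simp_rw [neg_mul] at h2 e2
  rw [integral_div, integral_add h1 h2, e1, e2, neg_sq]
  ring

/-- The integrand is the `t`-derivative of the one defining the moment generating function `exp (t²
/ 2)`. -/
theorem integral_mul_exp_gaussianReal (t : ℝ) :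
    Integrable (fun x => x * Real.exp (t * x)) (gaussianReal 0 1) ∧
      ∫ x, x * Real.exp (t * x) ∂gaussianReal 0 1 = t * Real.exp (t ^ 2 / 2) := by
  have hmem : t ∈ interior (integrableExpSet (fun x : ℝ => x) (gaussianReal 0 1)) := by simp
  constructor
  · simpa using integrable_pow_mul_exp_of_mem_interior_integrableExpSet hmem 1
  · have h1 := deriv_mgf hmem
    have h2 : mgf (fun x : ℝ => x) (gaussianReal 0 1) = fun t => Real.exp (t ^ 2 / 2) := by
      rw [mgf_fun_id_gaussianReal]; ext t; simp
    have h3 : HasDerivAt (fun t : ℝ => Real.exp (t ^ 2 / 2))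
        (Real.exp (t ^ 2 / 2) * ((2 : ℕ) * t ^ 1 * 1 / 2)) t :=
      (((hasDerivAt_id t).pow 2).div_const 2).exp
    rw [h2, h3.deriv] at h1
    rw [← h1]
    push_cast
    ring

theorem integrable_mul_sinh_gaussianReal (t : ℝ) :
    Integrable (fun x => x * Real.sinh (t * x)) (gaussianReal 0 1) := by
  have h1 := (integral_mul_exp_gaussianReal t).1
  have h2 := (integral_mul_exp_gaussianReal (-t)).1
  convert! (h1.sub h2).div_const 2 using 2 with x
  simp only [Real.sinh_eq, Pi.sub_apply]
  ring_nf

theorem integral_mul_sinh_gaussianReal (t : ℝ) :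
    ∫ x, x * Real.sinh (t * x) ∂gaussianReal 0 1 = t * Real.exp (t ^ 2 / 2) := by
  obtain ⟨h1, e1⟩ := integral_mul_exp_gaussianReal t
  obtain ⟨h2, e2⟩ := integral_mul_exp_gaussianReal (-t)
  have : (fun x => x * Real.sinh (t * x))
      = fun x => (x * Real.exp (t * x) - x * Real.exp (-t * x)) / 2 := by
    ext x; simp only [Real.sinh_eq]; ring_nf
  rw [this, integral_div, integral_sub h1 h2, e1, e2]
  ring_nf

theorem integrable_cosh_sq_gaussianReal (t : ℝ) :
    Integrable (fun x => Real.cosh (t * x) ^ 2) (gaussianReal 0 1) := by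
  have : (fun x => Real.cosh (t * x) ^ 2) = fun x => (Real.cosh (2 * t * x) + 1) / 2 := by
    ext x; rw [mul_assoc, Real.cosh_two_mul, Real.sinh_sq]; ring
  rw [this]
  exact ((integrable_cosh_gaussianReal _).add (integrable_const _)).div_const 2

theorem integral_cosh_sq_gaussianReal (t : ℝ) :
    ∫ x, Real.cosh (t * x) ^ 2 ∂gaussianReal 0 1 = (Real.exp (2 * t ^ 2) + 1) / 2 := by
  have : (fun x => Real.cosh (t * x) ^ 2) = fun x => (Real.cosh (2 * t * x) + 1) / 2 := by
    ext x; rw [mul_assoc, Real.cosh_two_mul, Real.sinh_sq]; ring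
  rw [this, integral_div, integral_add (integrable_cosh_gaussianReal _) (integrable_const _),
    integral_cosh_gaussianReal]
  simp
  ring_nf

theorem integrable_sq_sub_gaussianReal (t : ℝ) :
    Integrable (fun x => (x - t) ^ 2) (gaussianReal 0 1) := by
  have h : MemLp (fun x : ℝ => x - t) 2 (gaussianReal 0 1) :=
    (IsGaussian.memLp_two_id (μ := gaussianReal 0 1)).sub (memLp_const t)
  exact h.integrable_sq

theorem integral_sq_sub_gaussianReal (t : ℝ) :
    ∫ x, (x - t) ^ 2 ∂gaussianReal 0 1 = 1 + t ^ 2 := by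
  have h2 : Integrable (fun x : ℝ => x ^ 2) (gaussianReal 0 1) := by
    simpa using integrable_sq_sub_gaussianReal 0
  have h1 : Integrable (fun x : ℝ => x) (gaussianReal 0 1) := IsGaussian.integrable_id
  have e2 : ∫ x : ℝ, x ^ 2 ∂gaussianReal 0 1 = 1 := by
    have := variance_fun_id_gaussianReal (μ := 0) (v := 1)
    rw [variance_of_integral_eq_zero (by fun_prop) (by simp)] at this
    simpa using this
  have : (fun x : ℝ => (x - t) ^ 2) = fun x => x ^ 2 - (2 * t) * x + t ^ 2 := by
    ext x; ring
  have h3 := h1.const_mul (2 * t)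
  have h4 : Integrable (fun x : ℝ => x ^ 2 - 2 * t * x) (gaussianReal 0 1) := h2.sub h3
  rw [this, integral_add h4 (integrable_const _), integral_sub h2 h3, e2,
    integral_const_mul, integral_id_gaussianReal]
  simp

end ScalarGaussian

/-! ### Coordinates of a standard Gaussian vector -/

section StdGaussian

variable {ι : Type*} [Fintype ι]

theorem measurePreserving_eval_stdGaussian (i : ι) :
    MeasurePreserving (fun g : EuclideanSpace ℝ ι => g i)
      (stdGaussian (EuclideanSpace ℝ ι)) (gaussianReal 0 1) := by
  refine ⟨by fun_prop, ?_⟩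
  rw [← map_pi_eq_stdGaussian, Measure.map_map (by fun_prop) (by fun_prop)]
  exact (measurePreserving_eval (fun _ : ι => gaussianReal 0 1) i).map_eq

theorem integrable_eval_stdGaussian {f : ℝ → ℝ} (hf : Integrable f (gaussianReal 0 1)) (i : ι) :
    Integrable (fun g : EuclideanSpace ℝ ι => f (g i)) (stdGaussian (EuclideanSpace ℝ ι)) :=
  (measurePreserving_eval_stdGaussian i).integrable_comp_of_integrable hf

theorem integral_eval_stdGaussian {f : ℝ → ℝ} (hf : Integrable f (gaussianReal 0 1)) (i : ι) :
    ∫ g, f (g i) ∂stdGaussian (EuclideanSpace ℝ ι) = ∫ x, f x ∂gaussianReal 0 1 := by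
  have h := measurePreserving_eval_stdGaussian i
  rw [← h.map_eq, integral_map h.measurable.aemeasurable]
  rw [h.map_eq]
  exact hf.aestronglyMeasurable

theorem indepFun_eval_stdGaussian {i j : ι} (hij : i ≠ j) :
    IndepFun (fun g : EuclideanSpace ℝ ι => g i) (fun g => g j)
      (stdGaussian (EuclideanSpace ℝ ι)) := by
  have h : iIndepFun (fun (i : ι) (g : EuclideanSpace ℝ ι) => g i)
      (stdGaussian (EuclideanSpace ℝ ι)) := by
    rw [iIndepFun_iff_map_fun_eq_pi_map (fun i => by fun_prop)]
    simp_rw [(measurePreserving_eval_stdGaussian _).map_eq]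
    rw [← map_pi_eq_stdGaussian, Measure.map_map (by fun_prop) (by fun_prop)]
    exact Measure.map_id
  exact h.indepFun hij

theorem integrable_mul_eval_stdGaussian {f f' : ℝ → ℝ} (hf : Integrable f (gaussianReal 0 1))
    (hf' : Integrable f' (gaussianReal 0 1)) (hm : Measurable f) (hm' : Measurable f')
    {i j : ι} (hij : i ≠ j) :
    Integrable (fun g : EuclideanSpace ℝ ι => f (g i) * f' (g j))
      (stdGaussian (EuclideanSpace ℝ ι)) :=
  ((indepFun_eval_stdGaussian hij).comp hm hm').integrable_mul
    (integrable_eval_stdGaussian hf i) (integrable_eval_stdGaussian hf' j)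

theorem integral_mul_eval_stdGaussian {f f' : ℝ → ℝ} (hf : Integrable f (gaussianReal 0 1))
    (hf' : Integrable f' (gaussianReal 0 1)) (hm : Measurable f) (hm' : Measurable f')
    {i j : ι} (hij : i ≠ j) :
    ∫ g, f (g i) * f' (g j) ∂stdGaussian (EuclideanSpace ℝ ι)
      = (∫ x, f x ∂gaussianReal 0 1) * ∫ x, f' x ∂gaussianReal 0 1 := by
  rw [← integral_eval_stdGaussian hf i, ← integral_eval_stdGaussian hf' j]
  exact ((indepFun_eval_stdGaussian hij).comp hm hm').integral_fun_mul_eq_mul_integral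
    (integrable_eval_stdGaussian hf i).aestronglyMeasurable
    (integrable_eval_stdGaussian hf' j).aestronglyMeasurable

end StdGaussian

/-! ### Integrability and the upper bound -/

section TangentCone

variable {k p : ℕ} {a : EuclideanSpace ℝ (Fin p)}

theorem integrable_norm_sq_metricProj_descentTangentCone {E : Type*} [NormedAddCommGroup E]
    [InnerProductSpace ℝ E] [FiniteDimensional ℝ E] [MeasurableSpace E] [BorelSpace E]
    (Ω : E → ℝ) (z : E) :
    Integrable (fun g => ‖metricProj (descentTangentCone Ω z) g‖ ^ 2) (stdGaussian E) := by
  have h2 : Integrable (fun g : E => ‖g‖ ^ 2) (stdGaussian E) :=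
    (IsGaussian.memLp_two_id (μ := stdGaussian E)).integrable_norm_pow (by norm_num)
  have he := norm_sq_metricProj_of_cone (C := descentTangentCone Ω z) isClosed_closure
    (zero_mem_descentTangentCone Ω z) (smul_mem_descentTangentCone Ω z)
  have hm : Continuous (fun g => ‖metricProj (descentTangentCone Ω z) g‖ ^ 2) := by
    have : (fun g => ‖metricProj (descentTangentCone Ω z) g‖ ^ 2)
        = fun g => ‖g‖ ^ 2 - Metric.infDist g (descentTangentCone Ω z) ^ 2 := funext he
    rw [this]
    exact (continuous_norm.pow 2).sub ((Metric.continuous_infDist_pt _).pow 2)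
  refine h2.mono' hm.aestronglyMeasurable (Filter.Eventually.of_forall fun g => ?_)
  rw [Real.norm_of_nonneg (by positivity)]
  exact (he g).trans_le (by linarith [sq_nonneg (Metric.infDist g (descentTangentCone Ω z))])

/-- With `z = t (x - t) ≥ 0`, use `z² / 2 ≤ exp z`; the `cosh` covers both tails at once. Its
Gaussian mean is explicit, so no tail integral is needed. -/
theorem sq_sub_clip_le {t : ℝ} (ht : 0 < t) (x : ℝ) :
    (x - max (-t) (min x t)) ^ 2 ≤ 4 / t ^ 2 * Real.exp (-t ^ 2) * Real.cosh (t * x) := by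
  have key : ∀ x, t ≤ x →
      (x - t) ^ 2 ≤ 4 / t ^ 2 * Real.exp (-t ^ 2) * Real.cosh (t * x) := by
    intro x hx
    have hz : 0 ≤ t * (x - t) := mul_nonneg ht.le (by linarith)
    have h1 := Real.quadratic_le_exp_of_nonneg hz
    have h2 : Real.exp (t * (x - t)) = Real.exp (-t ^ 2) * Real.exp (t * x) := by
      rw [← Real.exp_add]; ring_nf
    have h3 : Real.exp (t * x) ≤ 2 * Real.cosh (t * x) := by
      rw [Real.cosh_eq]; linarith [Real.exp_pos (-(t * x))]
    have h4 : (t * (x - t)) ^ 2 ≤ 4 * (Real.exp (-t ^ 2) * Real.cosh (t * x)) := by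
      nlinarith [Real.exp_pos (-t ^ 2)]
    calc (x - t) ^ 2 = (t * (x - t)) ^ 2 / t ^ 2 := by field_simp
      _ ≤ 4 * (Real.exp (-t ^ 2) * Real.cosh (t * x)) / t ^ 2 := by gcongr
      _ = _ := by ring
  rcases le_total t x with h | h
  · rw [min_eq_right h, max_eq_right (by linarith)]
    exact key x h
  rw [min_eq_left h]
  rcases le_total x (-t) with h' | h'
  · rw [max_eq_left h']
    have := key (-x) (by linarith)
    rw [mul_neg, Real.cosh_neg] at this
    linarith
  · rw [max_eq_right h', sub_self]
    have := Real.cosh_pos (t * x)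
    rw [zero_pow two_ne_zero]
    positivity

/-- An element of the cone of subgradients of `κ_k` at `a`, close to `g`. -/
noncomputable def polarApprox (k : ℕ) (a : EuclideanSpace ℝ (Fin p)) (t : ℝ)
    (g : EuclideanSpace ℝ (Fin p)) : EuclideanSpace ℝ (Fin p) :=
  WithLp.toLp 2 fun i =>
    if a i = 0 then max (-t) (min (g i) t) else √(k : ℝ) * a i * max (√(k : ℝ) * a i * g i) t

/-- All atoms have the same `ℓ¹` norm `√k`, so subtracting `t |b i|` changes every pairing by the
same amount. After this shift `a` is optimal coordinate by coordinate: off its support the entries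
of `y` are at most `t` in modulus; on it they are at least `t` with the sign of `a i`, and `|b i| ≤
|a i|`. -/
theorem inner_polarApprox_le {t : ℝ} (ht : 0 < t) (ha : a ∈ cutAtoms k p)
    (g : EuclideanSpace ℝ (Fin p)) {b : EuclideanSpace ℝ (Fin p)} (hb : b ∈ cutAtoms k p) :
    inner ℝ (polarApprox k a t g) b ≤ inner ℝ (polarApprox k a t g) a := by
  have key : ∀ i, b i * polarApprox k a t g i - t * |b i|
      ≤ a i * polarApprox k a t g i - t * |a i| := by
    intro i
    have hbi := abs_le_of_mem_cutAtoms hb i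
    by_cases hi : a i = 0
    · have hy : |polarApprox k a t g i| ≤ t := by
        simp only [polarApprox, hi, if_true]
        exact abs_le.2 ⟨le_max_left _ _, max_le (by linarith) (min_le_right _ _)⟩
      have := (le_abs_self _).trans (abs_mul (b i) (polarApprox k a t g i)).le
      rw [hi]
      nlinarith [abs_nonneg (b i), abs_zero (α := ℝ)]
    · set m := max (√(k : ℝ) * a i * g i) t with hm
      have hmt : t ≤ m := le_max_right _ _
      have hy : polarApprox k a t g i = √(k : ℝ) * a i * m := by
        simp only [polarApprox, hi, if_false, hm]
      have h1 : |√(k : ℝ) * a i| ≤ 1 := by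
        rw [abs_mul, ha.2 i hi, abs_of_nonneg (Real.sqrt_nonneg _), mul_one_div]
        exact div_self_le_one _
      have h2 : a i * (√(k : ℝ) * a i * m) = |a i| * m := by
        have hk0 : √(k : ℝ) ≠ 0 := by
          intro h0
          have := ha.2 i hi
          rw [h0, div_zero, abs_eq_zero] at this
          exact hi this
        have : a i * √(k : ℝ) * a i = |a i| := by
          rw [mul_right_comm, ← abs_mul_abs_self, ha.2 i hi]
          field_simp
        rw [← this]; ring
      have h3 : b i * (√(k : ℝ) * a i * m) ≤ |b i| * m := by
        have := (le_abs_self _).trans (abs_mul (b i) (√(k : ℝ) * a i)).le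
        have h4 : |b i| * |√(k : ℝ) * a i| ≤ |b i| := mul_le_of_le_one_right (abs_nonneg _) h1
        calc b i * (√(k : ℝ) * a i * m) = (b i * (√(k : ℝ) * a i)) * m := by ring
          _ ≤ |b i| * m := by gcongr; linarith
      rw [hy, h2, ha.2 i hi]
      nlinarith
  have hs := Finset.sum_le_sum fun i (_ : i ∈ Finset.univ) => key i
  simp only [Finset.sum_sub_distrib, ← Finset.mul_sum, sum_abs_of_mem_cutAtoms ha,
    sum_abs_of_mem_cutAtoms hb] at hs
  simp only [PiLp.inner_apply, RCLike.inner_apply, conj_trivial]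
  linarith

theorem norm_sq_sub_polarApprox_le (hk : 1 ≤ k) {t : ℝ} (ht : 0 < t) (ha : a ∈ cutAtoms k p)
    (g : EuclideanSpace ℝ (Fin p)) :
    ‖g - polarApprox k a t g‖ ^ 2 ≤
      ∑ i, if a i = 0 then 4 / t ^ 2 * Real.exp (-t ^ 2) * Real.cosh (t * g i)
        else (g i - √(k : ℝ) * a i * t) ^ 2 := by
  rw [EuclideanSpace.real_norm_sq_eq]
  refine Finset.sum_le_sum fun i _ => ?_
  by_cases hi : a i = 0
  · simpa [polarApprox, hi] using sq_sub_clip_le ht (g i)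
  · simp only [PiLp.sub_apply, polarApprox, hi, if_false]
    have hs : (√(k : ℝ) * a i) ^ 2 = 1 := by
      rw [mul_pow, sq_of_mem_cutAtoms ha hi, Real.sq_sqrt (by positivity)]
      have : (k : ℝ) ≠ 0 := by positivity
      field_simp
    generalize √(k : ℝ) * a i = s at hs
    rcases le_total (s * g i) t with h | h
    · rw [max_eq_right h]
    · rw [max_eq_left h, ← mul_assoc, ← sq, hs, one_mul, sub_self, zero_pow two_ne_zero]
      positivity

theorem card_filter_eq_zero (ha : a ∈ cutAtoms k p) :
    ((Finset.univ.filter fun i => a i = 0).card : ℝ) = p - k := by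
  have h := Finset.card_filter_add_card_filter_not (s := Finset.univ) (fun i => a i = 0)
  have h2 := card_support_of_mem_cutAtoms ha
  rw [Finset.card_univ, Fintype.card_fin] at h
  simp only [ne_eq] at h2
  rw [h2] at h
  rw [eq_sub_iff_add_eq]
  exact_mod_cast h

theorem le_of_mem_cutAtoms (ha : a ∈ cutAtoms k p) : k ≤ p := by
  rw [← card_support_of_mem_cutAtoms ha]
  exact (Finset.card_filter_le _ _).trans (by simp)

theorem statDim_kappaNorm_le_of_pos (hk : 1 ≤ k) (ha : a ∈ cutAtoms k p) {t : ℝ} (ht : 0 < t) :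
    statDim a (kappaNorm k p)
      ≤ (p - k) * (4 / t ^ 2 * Real.exp (-(t ^ 2 / 2))) + k * (1 + t ^ 2) := by
  have hint : ∀ i, Integrable (fun x : ℝ => if a i = 0 then
      4 / t ^ 2 * Real.exp (-t ^ 2) * Real.cosh (t * x)
        else (x - √(k : ℝ) * a i * t) ^ 2) (gaussianReal 0 1) := by
    intro i
    split_ifs
    · exact (integrable_cosh_gaussianReal t).const_mul _
    · exact integrable_sq_sub_gaussianReal _
  have hval : ∀ i, (∫ x : ℝ, (if a i = 0 then
      4 / t ^ 2 * Real.exp (-t ^ 2) * Real.cosh (t * x)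
        else (x - √(k : ℝ) * a i * t) ^ 2) ∂gaussianReal 0 1)
      = if a i = 0 then 4 / t ^ 2 * Real.exp (-(t ^ 2 / 2)) else 1 + t ^ 2 := by
    intro i
    split_ifs with hi
    · rw [integral_const_mul, integral_cosh_gaussianReal, mul_assoc, ← Real.exp_add]
      ring_nf
    · rw [integral_sq_sub_gaussianReal, mul_pow, mul_pow, sq_of_mem_cutAtoms ha hi,
        Real.sq_sqrt (by positivity)]
      have : (k : ℝ) ≠ 0 := by positivity
      field_simp
  calc statDim a (kappaNorm k p)
      ≤ ∫ g, ∑ i, (if a i = 0 then 4 / t ^ 2 * Real.exp (-t ^ 2) * Real.cosh (t * g i)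
          else (g i - √(k : ℝ) * a i * t) ^ 2) ∂stdGaussian (EuclideanSpace ℝ (Fin p)) := by
        refine integral_mono (integrable_norm_sq_metricProj_descentTangentCone _ _)
          (integrable_finsetSum _ fun i _ => integrable_eval_stdGaussian (hint i) i) fun g => ?_
        refine le_trans ?_ (norm_sq_sub_polarApprox_le hk ht ha g)
        exact norm_sq_metricProj_le_of_polar isClosed_closure (zero_mem_descentTangentCone _ _)
          (smul_mem_descentTangentCone _ _) g fun h hh =>
            inner_nonpos_of_mem_descentTangentCone hk ha
              (fun b hb => inner_polarApprox_le ht ha g hb) hh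
    _ = ∑ i, if a i = 0 then 4 / t ^ 2 * Real.exp (-(t ^ 2 / 2)) else 1 + t ^ 2 := by
        rw [integral_finsetSum _ fun i _ => integrable_eval_stdGaussian (hint i) i]
        exact Finset.sum_congr rfl fun i _ =>
          (integral_eval_stdGaussian (hint i) i).trans (hval i)
    _ = _ := by
        rw [Finset.sum_ite, Finset.sum_const, Finset.sum_const, nsmul_eq_mul, nsmul_eq_mul,
          card_filter_eq_zero ha]
        congr 3
        exact card_support_of_mem_cutAtoms ha

theorem statDim_kappaNorm_le (hk : 1 ≤ k) (ha : a ∈ cutAtoms k p) :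
    statDim a (kappaNorm k p) ≤ 9 * k * Real.log ((p : ℝ) / k) + 16 * (k + 1) := by
  have hkp : (k : ℝ) ≤ p := by exact_mod_cast le_of_mem_cutAtoms ha
  have hk0 : (0 : ℝ) < k := by positivity
  have hp0 : (0 : ℝ) < p := by linarith
  have hlog : 0 ≤ Real.log ((p : ℝ) / k) := Real.log_nonneg ((one_le_div hk0).2 hkp)
  set L := Real.log ((p : ℝ) / k) with hL
  have ht2 : √(2 * L + 4) ^ 2 = 2 * L + 4 := Real.sq_sqrt (by positivity)
  -- Here `2 L` turns the tail into at most `k / p`, and `+ 4` makes `4 / t² ≤ 1` and keeps `t > 0`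
  -- when `p = k`.
  refine (statDim_kappaNorm_le_of_pos hk ha (t := √(2 * L + 4)) (by positivity)).trans ?_
  rw [ht2]
  have h1 : 4 / (2 * L + 4) ≤ 1 := (div_le_one (by positivity)).2 (by linarith)
  have h2 : Real.exp (-((2 * L + 4) / 2)) ≤ k / p := by
    calc Real.exp (-((2 * L + 4) / 2)) ≤ Real.exp (-L) := Real.exp_le_exp.2 (by linarith)
      _ = k / p := by rw [Real.exp_neg, hL, Real.exp_log (by positivity), inv_div]
  have h3 : ((p : ℝ) - k) * (4 / (2 * L + 4) * Real.exp (-((2 * L + 4) / 2))) ≤ k := by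
    calc ((p : ℝ) - k) * (4 / (2 * L + 4) * Real.exp (-((2 * L + 4) / 2)))
        ≤ p * (1 * (k / p)) := by
          gcongr
          linarith
      _ = k := by field_simp
  nlinarith [mul_nonneg hk0.le hlog]

/-! ### The lower bound -/

/-- A direction of descent of `κ_k` at `a`, correlated with `g`. -/
noncomputable def descentField (k : ℕ) (a : EuclideanSpace ℝ (Fin p)) (c t : ℝ)
    (g : EuclideanSpace ℝ (Fin p)) : EuclideanSpace ℝ (Fin p) :=
  WithLp.toLp 2 fun i => if a i = 0 then c * Real.sinh (t * g i)
    else -(c / √(k : ℝ) * a i * ∑ j with a j = 0, Real.cosh (t * g j))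

/-- The field is a nonnegative combination of swaps, over all pairs of a support index `i` and an
outside index `j`. The two signs of the new entry carry weights `exp (± t g_j)`: their difference
leaves `sinh` at `j`, their sum leaves `cosh` at `i`. -/
theorem descentField_mem (hk : 1 ≤ k) (ha : a ∈ cutAtoms k p) {c : ℝ} (hc : 0 ≤ c) (t : ℝ)
    (g : EuclideanSpace ℝ (Fin p)) :
    descentField k a c t g ∈ descentTangentCone (kappaNorm k p) a := by
  have hk0 : (0 : ℝ) < k := by positivity
  have hz := subset_convexHull ℝ _ ha
  set v := 1 / √(k : ℝ) with hv
  have hv0 : 0 ≤ v := by positivity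
  have hsum : descentField k a c t g = ∑ i with a i ≠ 0, ∑ j with a j = 0,
      ((c * v / 2 * Real.exp (t * g j)) •
          (EuclideanSpace.single j v - EuclideanSpace.single i (a i)) +
        (c * v / 2 * Real.exp (-(t * g j))) •
          (EuclideanSpace.single j (-v) - EuclideanSpace.single i (a i))) := by
    ext l
    simp only [WithLp.ofLp_sum, Finset.sum_apply, PiLp.add_apply, PiLp.smul_apply, PiLp.sub_apply,
      smul_eq_mul, PiLp.single_apply]
    by_cases hl : a l = 0
    · have : ∀ i ∈ Finset.univ.filter (fun i => a i ≠ 0),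
          ∀ j ∈ Finset.univ.filter (fun j => a j = 0),
          c * v / 2 * Real.exp (t * g j) * ((if l = j then v else 0) - if l = i then a i else 0) +
            c * v / 2 * Real.exp (-(t * g j)) *
              ((if l = j then -v else 0) - if l = i then a i else 0)
          = if l = j then c * (v * v) * Real.sinh (t * g j) else 0 := by
        intro i hi j hj
        have : l ≠ i := by rintro rfl; exact (Finset.mem_filter.1 hi).2 hl
        rw [if_neg this, Real.sinh_eq]
        split_ifs <;> ring
      rw [Finset.sum_congr rfl fun i hi => Finset.sum_congr rfl (this i hi)]
      simp only [Finset.sum_ite_eq, Finset.mem_filter, Finset.mem_univ, true_and, hl, if_true,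
        Finset.sum_const, card_support_of_mem_cutAtoms ha, nsmul_eq_mul, descentField]
      have : v * v = 1 / k := by rw [hv, ← sq, div_pow, Real.sq_sqrt hk0.le, one_pow]
      rw [this]
      field_simp
    · have : ∀ i ∈ Finset.univ.filter (fun i => a i ≠ 0),
          ∀ j ∈ Finset.univ.filter (fun j => a j = 0),
          c * v / 2 * Real.exp (t * g j) * ((if l = j then v else 0) - if l = i then a i else 0) +
            c * v / 2 * Real.exp (-(t * g j)) *
              ((if l = j then -v else 0) - if l = i then a i else 0)
          = if l = i then -(c * v * a i * Real.cosh (t * g j)) else 0 := by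
        intro i hi j hj
        have : l ≠ j := by rintro rfl; exact hl (Finset.mem_filter.1 hj).2
        rw [if_neg this, if_neg this, Real.cosh_eq]
        split_ifs <;> ring
      rw [Finset.sum_congr rfl fun i hi => Finset.sum_congr rfl (this i hi), Finset.sum_comm]
      simp only [Finset.sum_ite_eq, Finset.mem_filter, Finset.mem_univ, true_and, hl, if_false,
        ne_eq, not_false_eq_true, if_true, Finset.sum_neg_distrib, ← Finset.mul_sum, descentField]
      rw [hv]; ring
  rw [hsum]
  refine feasibleDirections_subset_descentTangentCone hk ha
    (sum_mem_feasibleDirections (convex_convexHull ℝ _) hz _ fun i hi =>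
      sum_mem_feasibleDirections (convex_convexHull ℝ _) hz _ fun j hj => ?_)
  have hi' := (Finset.mem_filter.1 hi).2
  have hj' := (Finset.mem_filter.1 hj).2
  have hd : ∀ w : ℝ, |w| = v → EuclideanSpace.single j w - EuclideanSpace.single i (a i)
      ∈ feasibleDirections (convexHull ℝ (cutAtoms k p)) a := fun w hw =>
    ⟨1, one_pos, by
      rw [one_smul]; exact subset_convexHull ℝ _ (swap_mem_cutAtoms hk ha hi' hj' hw)⟩
  exact add_mem_feasibleDirections (convex_convexHull ℝ _)
    (smul_mem_feasibleDirections hz (by positivity) (hd v (abs_of_nonneg hv0)))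
    (smul_mem_feasibleDirections hz (by positivity)
      (hd (-v) (by rw [abs_neg, abs_of_nonneg hv0])))

theorem inner_descentField (c t : ℝ) (g : EuclideanSpace ℝ (Fin p)) :
    inner ℝ g (descentField k a c t g) =
      c * ∑ j with a j = 0, g j * Real.sinh (t * g j) -
        c / √(k : ℝ) * ∑ i with ¬ a i = 0, ∑ j with a j = 0,
          a i * (g i * Real.cosh (t * g j)) := by
  have : inner ℝ g (descentField k a c t g) = ∑ i, if a i = 0 then
      c * (g i * Real.sinh (t * g i))
      else -(c / √(k : ℝ) * ∑ j with a j = 0, a i * (g i * Real.cosh (t * g j))) := by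
    simp only [PiLp.inner_apply, RCLike.inner_apply, conj_trivial]
    refine Finset.sum_congr rfl fun i _ => ?_
    simp only [descentField]
    split_ifs
    · ring
    · simp only [← Finset.mul_sum]; ring
  rw [this, Finset.sum_ite, Finset.sum_neg_distrib, ← Finset.mul_sum, ← Finset.mul_sum,
    ← sub_eq_add_neg]

theorem norm_sq_descentField (hk : 1 ≤ k) (ha : a ∈ cutAtoms k p) (c t : ℝ)
    (g : EuclideanSpace ℝ (Fin p)) :
    ‖descentField k a c t g‖ ^ 2 =
      c ^ 2 * ∑ j with a j = 0, (Real.cosh (t * g j) ^ 2 - 1) +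
        c ^ 2 / k * ∑ i with a i = 0, ∑ j with a j = 0,
          Real.cosh (t * g i) * Real.cosh (t * g j) := by
  have hk0 : (0 : ℝ) < k := by positivity
  have : ‖descentField k a c t g‖ ^ 2 = ∑ i, if a i = 0 then
      c ^ 2 * (Real.cosh (t * g i) ^ 2 - 1)
      else c ^ 2 / k ^ 2 * (∑ j with a j = 0, Real.cosh (t * g j)) ^ 2 := by
    rw [EuclideanSpace.real_norm_sq_eq]
    refine Finset.sum_congr rfl fun i _ => ?_
    simp only [descentField]
    split_ifs with hi
    · rw [mul_pow, Real.sinh_sq]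
    · rw [neg_sq, mul_pow, mul_pow, div_pow, Real.sq_sqrt hk0.le, sq_of_mem_cutAtoms ha hi]
      field_simp
  have hcard : (Finset.univ.filter fun i => ¬ a i = 0).card = k := card_support_of_mem_cutAtoms ha
  rw [this, Finset.sum_ite, ← Finset.mul_sum, Finset.sum_const, hcard, nsmul_eq_mul,
    sq (∑ j with _, _), Finset.sum_mul_sum]
  congr 1
  field_simp

theorem integral_sum_mul_sinh (s : Finset (Fin p)) (t : ℝ) :
    Integrable (fun g : EuclideanSpace ℝ (Fin p) => ∑ j ∈ s, g j * Real.sinh (t * g j))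
        (stdGaussian _) ∧
      ∫ g : EuclideanSpace ℝ (Fin p), ∑ j ∈ s, g j * Real.sinh (t * g j) ∂stdGaussian _
        = s.card * (t * Real.exp (t ^ 2 / 2)) := by
  have h := fun j => integrable_eval_stdGaussian (ι := Fin p) (integrable_mul_sinh_gaussianReal t) j
  refine ⟨integrable_finsetSum _ fun j _ => h j, ?_⟩
  rw [integral_finsetSum _ fun j _ => h j, Finset.sum_congr rfl fun j _ =>
    (integral_eval_stdGaussian (integrable_mul_sinh_gaussianReal t) j).trans
      (integral_mul_sinh_gaussianReal t), Finset.sum_const, nsmul_eq_mul]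

theorem integral_sum_cosh_sq_sub_one (s : Finset (Fin p)) (t : ℝ) :
    Integrable (fun g : EuclideanSpace ℝ (Fin p) => ∑ j ∈ s, (Real.cosh (t * g j) ^ 2 - 1))
        (stdGaussian _) ∧
      ∫ g : EuclideanSpace ℝ (Fin p), ∑ j ∈ s, (Real.cosh (t * g j) ^ 2 - 1) ∂stdGaussian _
        ≤ s.card * (Real.exp (2 * t ^ 2) / 2) := by
  have hi : Integrable (fun x => Real.cosh (t * x) ^ 2 - 1) (gaussianReal 0 1) :=
    (integrable_cosh_sq_gaussianReal t).sub (integrable_const _)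
  have hv : ∫ x, (Real.cosh (t * x) ^ 2 - 1) ∂gaussianReal 0 1 ≤ Real.exp (2 * t ^ 2) / 2 := by
    rw [integral_sub (integrable_cosh_sq_gaussianReal t) (integrable_const _),
      integral_cosh_sq_gaussianReal]
    simp
    linarith
  have h := fun j => integrable_eval_stdGaussian (ι := Fin p) hi j
  refine ⟨integrable_finsetSum _ fun j _ => h j, ?_⟩
  rw [integral_finsetSum _ fun j _ => h j, ← nsmul_eq_mul]
  exact Finset.sum_le_card_nsmul _ _ _ fun j _ => (integral_eval_stdGaussian hi j).trans_le hv

/-- The support part of `⟪g, h⟫` has mean zero: each term is a centred `g i` times a function of an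
independent coordinate. -/
theorem integral_sum_mul_cosh {s s' : Finset (Fin p)} (hs : Disjoint s s') (u : Fin p → ℝ)
    (t : ℝ) :
    Integrable (fun g : EuclideanSpace ℝ (Fin p) =>
        ∑ i ∈ s, ∑ j ∈ s', u i * (g i * Real.cosh (t * g j))) (stdGaussian _) ∧
      ∫ g : EuclideanSpace ℝ (Fin p), ∑ i ∈ s, ∑ j ∈ s', u i * (g i * Real.cosh (t * g j))
        ∂stdGaussian _ = 0 := by
  have hid : Integrable (fun x : ℝ => x) (gaussianReal 0 1) := IsGaussian.integrable_id
  have hne : ∀ i ∈ s, ∀ j ∈ s', i ≠ j := fun i hi j hj =>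
    fun h => Finset.disjoint_left.1 hs hi (h ▸ hj)
  have h : ∀ i ∈ s, ∀ j ∈ s', Integrable (fun g : EuclideanSpace ℝ (Fin p) =>
      u i * (g i * Real.cosh (t * g j))) (stdGaussian _) := fun i hi j hj =>
    (integrable_mul_eval_stdGaussian hid (integrable_cosh_gaussianReal t) (by fun_prop)
      (by fun_prop) (hne i hi j hj)).const_mul _
  refine ⟨integrable_finsetSum _ fun i hi => integrable_finsetSum _ (h i hi), ?_⟩
  rw [integral_finsetSum _ fun i hi => integrable_finsetSum _ (h i hi)]
  refine Finset.sum_eq_zero fun i hi => ?_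
  rw [integral_finsetSum _ (h i hi)]
  refine Finset.sum_eq_zero fun j hj => ?_
  rw [integral_const_mul, integral_mul_eval_stdGaussian (f := fun x => x)
    (f' := fun x => Real.cosh (t * x)) hid (integrable_cosh_gaussianReal t)
    (by fun_prop) (by fun_prop) (hne i hi j hj), integral_id_gaussianReal]
  ring

theorem integral_sum_cosh_mul_cosh (s : Finset (Fin p)) (t : ℝ) :
    Integrable (fun g : EuclideanSpace ℝ (Fin p) =>
        ∑ i ∈ s, ∑ j ∈ s, Real.cosh (t * g i) * Real.cosh (t * g j)) (stdGaussian _) ∧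
      ∫ g : EuclideanSpace ℝ (Fin p), ∑ i ∈ s, ∑ j ∈ s, Real.cosh (t * g i) * Real.cosh (t * g j)
        ∂stdGaussian _ ≤ s.card ^ 2 * Real.exp (t ^ 2) + s.card * (Real.exp (2 * t ^ 2) / 2) := by
  have h : ∀ i j, Integrable (fun g : EuclideanSpace ℝ (Fin p) =>
      Real.cosh (t * g i) * Real.cosh (t * g j)) (stdGaussian _) ∧
      ∫ g : EuclideanSpace ℝ (Fin p), Real.cosh (t * g i) * Real.cosh (t * g j) ∂stdGaussian _
        -- The diagonal value `(exp (2 t²) + 1) / 2` is relaxed so that all pairs share the term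
        -- `exp (t²)`.
        ≤ Real.exp (t ^ 2) + if i = j then Real.exp (2 * t ^ 2) / 2 else 0 := by
    intro i j
    by_cases hij : i = j
    · subst hij
      simp only [← sq, if_true]
      refine ⟨integrable_eval_stdGaussian (integrable_cosh_sq_gaussianReal t) i, ?_⟩
      rw [integral_eval_stdGaussian (integrable_cosh_sq_gaussianReal t) i,
        integral_cosh_sq_gaussianReal]
      have := Real.one_le_exp (sq_nonneg t)
      linarith
    · refine ⟨integrable_mul_eval_stdGaussian (integrable_cosh_gaussianReal t)
        (integrable_cosh_gaussianReal t) (by fun_prop) (by fun_prop) hij, ?_⟩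
      rw [integral_mul_eval_stdGaussian (f := fun x => Real.cosh (t * x))
        (f' := fun x => Real.cosh (t * x)) (integrable_cosh_gaussianReal t)
        (integrable_cosh_gaussianReal t) (by fun_prop) (by fun_prop) hij,
        integral_cosh_gaussianReal, ← Real.exp_add, if_neg hij, add_halves, add_zero]
  have h' := fun i => integrable_finsetSum s fun j _ => (h i j).1
  refine ⟨integrable_finsetSum _ fun i _ => h' i, ?_⟩
  rw [integral_finsetSum _ fun i _ => h' i]
  calc ∑ i ∈ s, ∫ g : EuclideanSpace ℝ (Fin p),
        ∑ j ∈ s, Real.cosh (t * g i) * Real.cosh (t * g j) ∂stdGaussian _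
      ≤ ∑ i ∈ s, ∑ j ∈ s, (Real.exp (t ^ 2) + if i = j then Real.exp (2 * t ^ 2) / 2 else 0) := by
        refine Finset.sum_le_sum fun i _ => ?_
        rw [integral_finsetSum _ fun j _ => (h i j).1]
        exact Finset.sum_le_sum fun j _ => (h i j).2
    _ = _ := by
        simp only [Finset.sum_add_distrib, Finset.sum_const, Finset.sum_ite_eq, nsmul_eq_mul]
        rw [← Finset.sum_filter, Finset.filter_mem_eq_inter, Finset.inter_self, Finset.sum_const,
          nsmul_eq_mul]
        ring

theorem le_statDim_kappaNorm_of_nonneg (hk : 1 ≤ k) (ha : a ∈ cutAtoms k p) {c : ℝ} (hc : 0 ≤ c)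
    (t : ℝ) :
    2 * (c * ((p - k) * (t * Real.exp (t ^ 2 / 2)))) -
        (c ^ 2 * ((p - k) * (Real.exp (2 * t ^ 2) / 2)) +
          c ^ 2 / k * ((p - k) ^ 2 * Real.exp (t ^ 2) + (p - k) * (Real.exp (2 * t ^ 2) / 2)))
      ≤ statDim a (kappaNorm k p) := by
  have hdisj : Disjoint (Finset.univ.filter fun i => ¬ a i = 0)
      (Finset.univ.filter fun i => a i = 0) :=
    (Finset.disjoint_filter_filter_not _ _ _).symm
  obtain ⟨i1, e1⟩ := integral_sum_mul_sinh (Finset.univ.filter fun i => a i = 0) t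
  obtain ⟨i2, e2⟩ := integral_sum_mul_cosh hdisj a t
  obtain ⟨i3, e3⟩ := integral_sum_cosh_sq_sub_one (Finset.univ.filter fun i => a i = 0) t
  obtain ⟨i4, e4⟩ := integral_sum_cosh_mul_cosh (Finset.univ.filter fun i => a i = 0) t
  rw [card_filter_eq_zero ha] at e1 e3 e4
  have j1 := ((i1.const_mul c).sub (i2.const_mul (c / √(k : ℝ)))).const_mul 2
  have j2 := (i3.const_mul (c ^ 2)).add (i4.const_mul (c ^ 2 / k))
  have hmono := integral_mono (j1.sub j2)
    (integrable_norm_sq_metricProj_descentTangentCone (kappaNorm k p) a) fun g => by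
      have := le_norm_sq_metricProj_of_cone isClosed_closure
        (zero_mem_descentTangentCone (kappaNorm k p) a)
        (smul_mem_descentTangentCone (kappaNorm k p) a) g (descentField_mem hk ha hc t g)
      rw [inner_descentField, norm_sq_descentField hk ha] at this
      exact this
  refine le_trans ?_ hmono
  rw [integral_sub' j1 j2, integral_const_mul,
    integral_sub' (i1.const_mul c) (i2.const_mul (c / √(k : ℝ))), integral_const_mul,
    integral_const_mul, e1, e2, integral_add' (i3.const_mul (c ^ 2)) (i4.const_mul (c ^ 2 / k)),
    integral_const_mul, integral_const_mul, mul_zero, sub_zero]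
  gcongr

theorem le_statDim_kappaNorm (hk : 1 ≤ k) (ha : a ∈ cutAtoms k p) :
    (k : ℝ) / (2 * Real.pi) * Real.log (((p : ℝ) - k) / (k + 1)) ≤ statDim a (kappaNorm k p) := by
  have hkp : (k : ℝ) ≤ p := by exact_mod_cast le_of_mem_cutAtoms ha
  have hk0 : (0 : ℝ) < k := by positivity
  have hpi := Real.pi_gt_three
  -- When the ratio is at most `1` the claimed bound is nonpositive; this includes `p = k`, where
  -- `Real.log 0 = 0`.
  rcases le_or_gt (((p : ℝ) - k) / (k + 1)) 1 with h | h
  · have h1 := Real.log_nonpos (div_nonneg (sub_nonneg.2 hkp) (by positivity)) h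
    have h2 : 0 ≤ statDim a (kappaNorm k p) := integral_nonneg fun g => by positivity
    exact (mul_nonpos_of_nonneg_of_nonpos (by positivity) h1).trans h2
  set r := ((p : ℝ) - k) / (k + 1) with hr
  have hr0 : 0 < r := by linarith
  have hn : (p : ℝ) - k = (k + 1) * r := by rw [hr]; field_simp
  have hlog : 0 ≤ Real.log r := Real.log_nonneg h.le
  set L := Real.log r with hL
  have ht2 : √L ^ 2 = L := Real.sq_sqrt hlog
  have hE : Real.exp (L / 2) ^ 2 = r := by
    rw [← Real.exp_nat_mul, hL]; push_cast
    rw [mul_div_cancel₀ _ two_ne_zero, Real.exp_log hr0]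
  have hE1 : Real.exp L = r := Real.exp_log hr0
  have hE2 : Real.exp (2 * L) = r ^ 2 := by rw [two_mul, Real.exp_add, hE1, sq]
  have hE0 := Real.exp_pos (L / 2)
  -- With `t² = L`, this `c` makes the mean of `⟪g, h⟫` equal to `k L`, while the bound on the mean
  -- of `‖h‖²` becomes `3 k L / 2`.
  have key := le_statDim_kappaNorm_of_nonneg hk ha
    (c := k * √L / ((k + 1) * r * Real.exp (L / 2))) (by positivity) √L
  rw [ht2, hn, hE1, hE2] at key
  have hc2 : (k * √L / ((k + 1) * r * Real.exp (L / 2))) ^ 2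
      = k ^ 2 * L / ((k + 1) ^ 2 * r ^ 3) := by
    rw [div_pow, mul_pow, mul_pow, mul_pow, ht2, hE]; ring_nf
  have hc1 : k * √L / ((k + 1) * r * Real.exp (L / 2)) *
      ((k + 1) * r * (√L * Real.exp (L / 2))) = k * L := by
    have : k * √L / ((k + 1) * r * Real.exp (L / 2)) *
      ((k + 1) * r * (√L * Real.exp (L / 2))) = k * √L ^ 2 := by field_simp
    rw [this, ht2]
  rw [hc2, hc1] at key
  refine le_trans ?_ key
  have e : 2 * (k * L) - (k ^ 2 * L / ((k + 1) ^ 2 * r ^ 3) * ((k + 1) * r * (r ^ 2 / 2)) +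
      k ^ 2 * L / ((k + 1) ^ 2 * r ^ 3) / k *
        (((k + 1) * r) ^ 2 * r + (k + 1) * r * (r ^ 2 / 2))) = k * L / 2 := by
    field_simp; ring
  rw [e, div_mul_eq_mul_div]
  -- The bound obtained is `k L / 2`; only `2 ≤ 2 π` is needed to finish.
  exact div_le_div_of_nonneg_left (by positivity) (by norm_num) (by linarith)

end TangentCone

theorem mainTheorem10 (k p : ℕ) (hk : 1 ≤ k) (a : EuclideanSpace ℝ (Fin p))
    (ha : a ∈ cutAtoms k p) :
    Integrable (fun g => ‖metricProj (descentTangentCone (kappaNorm k p) a) g‖ ^ 2)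
        (stdGaussian (EuclideanSpace ℝ (Fin p))) ∧
      (k : ℝ) / (2 * Real.pi) * Real.log (((p : ℝ) - k) / (k + 1)) ≤ statDim a (kappaNorm k p) ∧
      statDim a (kappaNorm k p) ≤ 9 * k * Real.log ((p : ℝ) / k) + 16 * (k + 1) :=
  ⟨integrable_norm_sq_metricProj_descentTangentCone _ _, le_statDim_kappaNorm hk ha,
    statDim_kappaNorm_le hk ha⟩
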